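/- **Setting.** Fix $L\ge 1$, a signal length $N$, channel numbers $m_0=1,m_1,\dots,m_L$ and filter lengths $1\le n_i\le N$ ($1\le i\le L$). For $1\le i\le L$ let $\mathbf D_i\in\mathbb R^{Nm_{i-1}\times Nm_i}$ be a convolutional dictionary: its columns (atoms) are $m_i$ filters of spatial length $n_i$ with $m_{i-1}$ channels, placed at each of the $N$ cyclic locations. Put $\mathbf D^{(i)}=\mathbf D_1\cdots\mathbf D_i$; this is a convolutional dictionary with filters of length $n_i^{\mathrm{eff}}=\sum_{j\le i}n_j-(i-1)$. All atoms of $\mathbf D_1,\dots,\mathbf D_L$ and of $\mathbf D^{(L)}$ have unit $\ell_2$ norm, and $\mu(\mathbf D)=\max_{i\ne j}|\mathbf d_i^T\mathbf d_j|$ is the mutual coherence. For filters of length $n$, the patch of a vector at location $t$ consists of its entries (all channels) at the locations $t,\dots,t+n-1$ (mod $N$), and the stripe at $t$ of its entries at the locations $t-n+1,\dots,t+n-1$ (mod $N$); $\|\cdot\|^s_{0,\infty}$ is the maximal number of non-zeros in a stripe, and $\|\cdot\|^p_{2,\infty}$ is the maximal $\ell_2$ norm of a patch. Stripes and patches are those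 of the dictionary under consideration: filter length $n_i$ for $\mathbf D_i$, and $n_L^{\mathrm{eff}}$ for $\mathbf D^{(L)}$; write $\|\gamma_L\|^{s,\mathrm{eff}}_{0,\infty}$ and $\|\cdot\|^{p,\mathrm{eff}}_{2,\infty}$ in the latter case. A vector $\gamma$ with support $\mathcal T$ has the N.V.S. (non-vanishing support) property for $\mathbf D$ if $\|\mathbf D\gamma\|_0$ equals the number of non-zero rows of $\mathbf D_{\mathcal T}$, the submatrix of the columns of $\mathbf D$ in $\mathcal T$. **Theorem.** Let $\mathbf x=\gamma_0$ belong to the multi-layer model $\mathcal M_\lambda$ through $\gamma_1,\dots,\gamma_L$, i.e. $\gamma_{i-1}=\mathbf D_i\gamma_i$ and $\|\gamma_i\|^s_{0,\infty}\le\lambda_i$ for $1\le i\le L$. Let $\mathbf y=\mathbf x+\mathbf v$ with $\|\mathbf y-\mathbf x\|_2\le\mathcal E_0$, and let $\epsilon_0=\|\mathbf v\|^{p,\mathrm{eff}}_{2,\infty}$. Assume that for every $1\le i\le L$ the vector $\gamma_i$ has the N.V.S. property for $\mathbf D_i$ and $$\|\gamma_i\|^s_{0,\infty}=\lambda_i<\tfrac12\Big(1+\frac1{\mu(\mathbf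 D_i)}\Big),$$ and that $$\|\gamma_L\|^{s,\mathrm{eff}}_{0,\infty}<\frac12\Big(1+\frac1{\mu(\mathbf D^{(L)})}\Big)-\frac1{\mu(\mathbf D^{(L)})}\cdot\frac{\epsilon_0}{|\gamma_L^{\min}|},$$ where $|\gamma_L^{\min}|$ is the smallest absolute value of a non-zero entry of $\gamma_L$. (Both conditions are understood after multiplication by $2\mu$, so that for $\mu=0$ the first is void and the second reads $\epsilon_0<|\gamma_L^{\min}|/2$; if $\gamma_L=0$, the second condition is void.) Let $\hat\gamma_L$ be the result of $\|\gamma_L\|_0$ iterations of Orthogonal Matching Pursuit applied to $\mathbf y$ and $\mathbf D^{(L)}$, with any way to break ties, and let $\hat\gamma_{i-1}=\mathbf D_i\hat\gamma_i$ for $i=L,\dots,1$. Then for every $1\le i\le L$: 1. $\operatorname{Supp}(\hat\gamma_i)\subseteq\operatorname{Supp}(\gamma_i)$; 2. $\displaystyle\|\hat\gamma_i-\gamma_i\|_2^2\le\frac{\mathcal E_0^2}{1-\mu(\mathbf D^{(L)})\big(\|\gamma_L\|^{s,\mathrm{eff}}_{0,\infty}-1\big)}\Big(\frac32\Big)^{L-i}.$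 -/

import Mathlib

open scoped Matrix

namespace MLCSC

noncomputable section

/-- The Euclidean norm of a finite real vector. -/
def l2 {ι : Type*} [Fintype ι] (v : ι → ℝ) : ℝ := ‖WithLp.toLp 2 v‖

open Classical in
/-- The number of non-zero entries of a vector. -/
def l0 {ι : Type*} [Fintype ι] (v : ι → ℝ) : ℕ :=
  (Finset.univ.filter fun j => v j ≠ 0).card

/-- The smallest absolute value of an entry in the support (`0` for the zero vector). -/
def minAbs {ι : Type*} (v : ι → ℝ) : ℝ :=
  sInf {a : ℝ | ∃ j, v j ≠ 0 ∧ a = |v j|}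

/-- All columns (atoms) of `D` have unit Euclidean norm. -/
def UnitAtoms {ι κ : Type*} [Fintype ι] (D : Matrix ι κ ℝ) : Prop :=
  ∀ j, l2 (fun p => D p j) = 1

/-- Mutual coherence of a dictionary with unit-norm atoms: the maximum of `|⟨d_i, d_j⟩|` over
`i ≠ j` (`0` if there are fewer than two atoms). -/
def coherence {ι κ : Type*} [Fintype ι] (D : Matrix ι κ ℝ) : ℝ :=
  sSup {a : ℝ | ∃ i j, i ≠ j ∧ a = |∑ p, D p i * D p j|}

open Classical in
/-- Non-vanishing support: the number of non-zero entries of `D γ` equals the number of non-zero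
rows of the submatrix of `D` formed by the columns in the support of `γ`. -/
def NVS {ι κ : Type*} [Fintype ι] [Fintype κ] (D : Matrix ι κ ℝ) (g : κ → ℝ) : Prop :=
  l0 (D *ᵥ g) = (Finset.univ.filter fun p => ∃ j, g j ≠ 0 ∧ D p j ≠ 0).card

section Convolutional

variable {N : ℕ} [NeZero N]

/-- The convolutional dictionary generated by `m` filters of spatial length `n`, acting on signals
with `m'` channels: the atom `(q, k)` is the filter `k` placed at the (cyclic) location `q`, so each
`k` contributes a banded (block-)circulant matrix. Entries of signals and of representations
are indexed by pairs (location, channel). -/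
def convDict {m' m n : ℕ} (f : Fin m → Fin n → Fin m' → ℝ) :
    Matrix (ZMod N × Fin m') (ZMod N × Fin m) ℝ :=
  Matrix.of fun p q =>
    if h : (p.1 - q.1).val < n then f q.2 ⟨(p.1 - q.1).val, h⟩ p.2 else 0

open Classical in
/-- The patch of `v` at location `t` for filters of length `n`: the entries of `v`, in all channels,
at the locations `t, t + 1, …, t + n - 1` (the other entries are set to zero). -/
def patch {m : ℕ} (n : ℕ) (v : ZMod N × Fin m → ℝ) (t : ZMod N) : ZMod N × Fin m → ℝ :=
  fun p => if (p.1 - t).val < n then v p else 0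

open Classical in
/-- The stripe of `g` at location `t` for filters of length `n`: the entries of `g`, in all
channels, at the locations `t - n + 1, …, t + n - 1` (the other entries are set to zero). These
are the `(2 n - 1) m` coefficients of the atoms that can overlap the patch at `t`. -/
def stripe {m : ℕ} (n : ℕ) (g : ZMod N × Fin m → ℝ) (t : ZMod N) : ZMod N × Fin m → ℝ :=
  fun q => if (q.1 - t).val < n ∨ (t - q.1).val < n then g q else 0

/-- The `ℓ_{0,∞}` pseudo-norm: maximal number of non-zeros in a stripe, for filters of
length `n`. -/
def stripeL0 {m : ℕ} (n : ℕ) (g : ZMod N × Fin m → ℝ) : ℕ :=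
  Finset.univ.sup fun t : ZMod N => l0 (stripe n g t)

/-- The patch `ℓ_{2,∞}` norm: maximal Euclidean norm of a patch, for filters of length `n`. -/
def patchL2 {m : ℕ} (n : ℕ) (v : ZMod N × Fin m → ℝ) : ℝ :=
  Finset.univ.sup' Finset.univ_nonempty fun t : ZMod N => l2 (patch n v t)

section MultiLayer

/-! Layers are numbered `0, 1, …, L`, layer `0` being the signal. Layer `i` has `m i` channels.
The dictionary from layer `i + 1` to layer `i` has `m (i + 1)` filters of length `n i`, given
by `f i`; so it is the `(i + 1)`-st dictionary in a numbering from one. -/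

variable {m n : ℕ → ℕ}

/-- The dictionary from layer `i + 1` to layer `i`. -/
def dict (N : ℕ) [NeZero N] (f : (i : ℕ) → Fin (m (i + 1)) → Fin (n i) → Fin (m i) → ℝ) (i : ℕ) :
    Matrix (ZMod N × Fin (m i)) (ZMod N × Fin (m (i + 1))) ℝ :=
  convDict (f i)

/-- The effective dictionary `D^{(i)}`, the product of the first `i` dictionaries. -/
def effDict (N : ℕ) [NeZero N] (f : (i : ℕ) → Fin (m (i + 1)) → Fin (n i) → Fin (m i) → ℝ) :
    (i : ℕ) → Matrix (ZMod N × Fin (m 0)) (ZMod N × Fin (m i)) ℝ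
  | 0 => 1
  | i + 1 => effDict N f i * dict N f i

/-- The spatial length `n_1 + ⋯ + n_i - (i - 1)` of the atoms of the effective dictionary
`D^{(i)}`. -/
def effLen (n : ℕ → ℕ) (i : ℕ) : ℕ := (∑ j ∈ Finset.range i, n j) - (i - 1)

/-- The signal `g 0` belongs to the multi-layer convolutional sparse coding model with sparsity
levels `lam`, through the representations `g 1, …, g L`. -/
def InModel (L : ℕ) (f : (i : ℕ) → Fin (m (i + 1)) → Fin (n i) → Fin (m i) → ℝ)
    (lam : ℕ → ℕ) (g : (i : ℕ) → ZMod N × Fin (m i) → ℝ) : Prop :=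
  ∀ i < L, g i = dict N f i *ᵥ g (i + 1) ∧ stripeL0 (n i) (g (i + 1)) ≤ lam (i + 1)

end MultiLayer

end Convolutional

section Pursuit

variable {ι κ : Type*} [Fintype ι] [Fintype κ]

/-- `g` minimizes `‖y - D g‖_2` among the vectors supported in `T`. -/
def IsLeastSquares (D : Matrix ι κ ℝ) (y : ι → ℝ) (T : Finset κ) (g : κ → ℝ) : Prop :=
  Function.support g ⊆ ↑T ∧
    ∀ g' : κ → ℝ, Function.support g' ⊆ ↑T → l2 (y - D *ᵥ g) ≤ l2 (y - D *ᵥ g')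

open Classical in
/-- Orthogonal Matching Pursuit (for unit-norm atoms). `OMP D y k T g` says that some run of the
algorithm (with some way to break ties) has after `k` iterations selected the atoms in `T` and
computed the estimate `g`: every iteration selects an atom with the largest correlation in
absolute value with the current residual `y - D g`, and then projects `y` onto the span of all the
atoms selected so far. -/
inductive OMP (D : Matrix ι κ ℝ) (y : ι → ℝ) : ℕ → Finset κ → (κ → ℝ) → Prop
  | init : OMP D y 0 ∅ 0
  | step {k : ℕ} {T : Finset κ} {g g' : κ → ℝ} {j : κ} :
      OMP D y k T g →
      (∀ j', |(Dᵀ *ᵥ (y - D *ᵥ g)) j'| ≤ |(Dᵀ *ᵥ (y - D *ᵥ g)) j|) →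
      IsLeastSquares D y (insert j T) g' →
      OMP D y (k + 1) (insert j T) g'

/-- `gh` is an output of the multi-layer pursuit with `K` iterations of Orthogonal Matching
Pursuit: the deepest estimate `gh L` is obtained from `y` and the effective dictionary `D^{(L)}`,
and it is propagated to the other layers by the dictionaries. -/
def IsMLPursuit {N : ℕ} [NeZero N] {m n : ℕ → ℕ} (L : ℕ)
    (f : (i : ℕ) → Fin (m (i + 1)) → Fin (n i) → Fin (m i) → ℝ)
    (y : ZMod N × Fin (m 0) → ℝ) (K : ℕ) (gh : (i : ℕ) → ZMod N × Fin (m i) → ℝ) : Prop :=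
  (∃ T, OMP (effDict N f L) y K T (gh L)) ∧ ∀ i < L, gh i = dict N f i *ᵥ gh (i + 1)

end Pursuit

end

end MLCSC

/-!
Each atom of a convolutional dictionary meets only the atoms located in its stripe. So a vector
supported in `S = supp γ` sees, in every row of the Gram matrix `Dᵀ * D`, at most
`s = ‖γ‖_{0,∞}` non-zero entries in the columns of `S`; off the diagonal their absolute values are
at most the coherence `μ`. The whole argument depends on the convolutional structure only through
this count (`gramSparse_of_hasAtomLength`) and through the bound `|⟨d_j, v⟩| ≤ ‖v‖_{2,∞}`
(`abs_transpose_mulVec_le_patchL2`). Both also hold for the effective dictionary,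
whose atoms have length `effLen`.

*Deepest layer.* As long as the selected set `T ⊂ S` is incomplete, the error `γ - g` has an entry
of size at least `|γ_min|`. At its largest entry, of size `a`, the correlation with the residual is
at least `a (1 - μ (s - 1)) - ε₀`, while off `S` it is at most `a μ s + ε₀`; the hypothesis makes
the former larger. So Orthogonal Matching Pursuit picks an atom of `S`, which is new because the
residual is orthogonal to the atoms already selected. After `|S|` steps it has selected exactly `S`
(`OMP.subset_support`), and `D (ĝ - γ)` is the projection of the noise to the span of these atoms,
of norm at most `E₀`. The Gershgorin-type estimate
`(1 - μ (s - 1)) ‖δ‖² ≤ ‖D δ‖² ≤ (1 + μ (s - 1)) ‖δ‖²` (`abs_l2_mulVec_sq_sub_le`) gives the bound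
on `ĝ - γ`.

*Propagation.* The non-vanishing support property says that the rows touched by the atoms of
`supp γ_i` are exactly the support of `γ_{i-1}`, so inclusion of supports passes from one layer to
the next (`NVS.support_mulVec_subset`). The upper half of the estimate costs a factor
`1 + μ (λ_i - 1) ≤ 3 / 2` per layer.
-/

namespace MLCSC

/-! ### Euclidean norm, coherence and smallest entry -/

section Basic

variable {ι κ : Type*} [Fintype ι]

lemma l2_nonneg (v : ι → ℝ) : 0 ≤ l2 v := norm_nonneg _

lemma l2_sq (v : ι → ℝ) : l2 v ^ 2 = v ⬝ᵥ v := by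
  rw [l2, EuclideanSpace.real_norm_sq_eq]
  simp [dotProduct, sq]

lemma abs_dotProduct_le_l2_mul_l2 (u v : ι → ℝ) : |u ⬝ᵥ v| ≤ l2 u * l2 v := by
  refine abs_le_of_sq_le_sq ?_ (mul_nonneg (l2_nonneg u) (l2_nonneg v))
  rw [mul_pow, l2_sq, l2_sq]
  simpa [dotProduct, sq] using Finset.sum_mul_sq_le_sq_mul_sq Finset.univ u v

lemma coherence_nonneg (D : Matrix ι κ ℝ) : 0 ≤ coherence D := by
  refine Real.sSup_nonneg ?_
  rintro a ⟨i, j, -, rfl⟩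
  exact abs_nonneg _

lemma abs_gram_le_coherence [Finite κ] (D : Matrix ι κ ℝ) {i j : κ} (h : i ≠ j) :
    |(Dᵀ * D) i j| ≤ coherence D := by
  refine le_csSup ?_ ⟨i, j, h, by simp [Matrix.mul_apply]⟩
  refine (Set.Finite.subset
    (Set.finite_range fun q : κ × κ => |∑ p, D p q.1 * D p q.2|) ?_).bddAbove
  rintro a ⟨i, j, -, rfl⟩
  exact ⟨(i, j), rfl⟩

lemma gram_self {D : Matrix ι κ ℝ} (hD : UnitAtoms D) (j : κ) : (Dᵀ * D) j j = 1 := by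
  have h := l2_sq fun p => D p j
  rw [hD j] at h
  simpa [Matrix.mul_apply, dotProduct] using h.symm

lemma gram_symm (D : Matrix ι κ ℝ) (i j : κ) : (Dᵀ * D) i j = (Dᵀ * D) j i := by
  simp [Matrix.mul_apply, mul_comm]

omit [Fintype ι] in
lemma minAbs_le (v : ι → ℝ) {j : ι} (hj : v j ≠ 0) : minAbs v ≤ |v j| := by
  refine csInf_le ⟨0, ?_⟩ ⟨j, hj, rfl⟩
  rintro a ⟨i, -, rfl⟩
  exact abs_nonneg _

lemma minAbs_pos {v : ι → ℝ} (hv : v ≠ 0) : 0 < minAbs v := by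
  obtain ⟨j, hj⟩ := Function.ne_iff.mp hv
  have hfin : {a : ℝ | ∃ j, v j ≠ 0 ∧ a = |v j|}.Finite := by
    refine (Set.finite_range fun j => |v j|).subset ?_
    rintro a ⟨i, -, rfl⟩
    exact ⟨i, rfl⟩
  have hne : {a : ℝ | ∃ j, v j ≠ 0 ∧ a = |v j|}.Nonempty := ⟨|v j|, j, hj, rfl⟩
  obtain ⟨i, hi, h⟩ := hne.csInf_mem hfin
  rw [minAbs, h]
  exact abs_pos.mpr hi

end Basic

/-! ### Gram matrices with sparse rows -/

section Gram

variable {ι κ : Type*} [Fintype ι]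

open Classical in
/-- Every atom of `D` has a non-zero inner product with at most `s` of the atoms in `S`. If `D` has
unit atoms, an atom of `S` is counted among its own neighbours. -/
def GramSparse (D : Matrix ι κ ℝ) (S : Finset κ) (s : ℕ) : Prop :=
  ∀ i, (S.filter fun j => (Dᵀ * D) i j ≠ 0).card ≤ s

variable {D : Matrix ι κ ℝ} {S : Finset κ} {s : ℕ}

lemma GramSparse.one_le (hs : GramSparse D S s) (hD : UnitAtoms D) {i : κ} (hi : i ∈ S) :
    1 ≤ s := by
  classical
  refine le_trans (Finset.card_pos.mpr ⟨i, ?_⟩) (hs i)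
  simp [hi, gram_self hD]

open Classical in
lemma GramSparse.card_offDiag_le (hs : GramSparse D S s) (hD : UnitAtoms D) {i : κ}
    (hi : i ∈ S) : ((S.filter fun j => j ≠ i ∧ (Dᵀ * D) i j ≠ 0).card : ℝ) ≤ (s : ℝ) - 1 := by
  have h : (S.filter fun j => j ≠ i ∧ (Dᵀ * D) i j ≠ 0) =
      (S.filter fun j => (Dᵀ * D) i j ≠ 0).erase i := by
    ext j
    simp only [Finset.mem_filter, Finset.mem_erase]
    tauto
  have hmem : i ∈ S.filter fun j => (Dᵀ * D) i j ≠ 0 := by simp [hi, gram_self hD]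
  have hcard := Finset.card_erase_add_one hmem
  have hle := hs i
  rw [h, le_sub_iff_add_le]
  exact_mod_cast hcard.trans_le hle

variable [Fintype κ]

lemma l2_mulVec_sq (D : Matrix ι κ ℝ) (δ : κ → ℝ) :
    l2 (D *ᵥ δ) ^ 2 = δ ⬝ᵥ ((Dᵀ * D) *ᵥ δ) := by
  rw [l2_sq, ← Matrix.mulVec_mulVec, Matrix.dotProduct_mulVec δ, Matrix.vecMul_transpose]

open Classical in
lemma gram_mulVec_apply (hD : UnitAtoms D) (δ : κ → ℝ) (i : κ) :
    ((Dᵀ * D) *ᵥ δ) i = δ i + ∑ j, if j ≠ i then (Dᵀ * D) i j * δ j else 0 := by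
  rw [Matrix.mulVec, dotProduct, ← Finset.add_sum_erase _ _ (Finset.mem_univ i), gram_self hD,
    one_mul, ← Finset.sum_filter]
  congr 2
  ext j
  simp

open Classical in
/-- In a row of the Gram matrix, the off-diagonal part contributes at most `μ a` per neighbour. -/
lemma abs_offDiag_sum_le (D : Matrix ι κ ℝ) {δ : κ → ℝ} (hδ : Function.support δ ⊆ ↑S) {a : ℝ}
    (ha : ∀ j, |δ j| ≤ a) (i : κ) :
    |∑ j, if j ≠ i then (Dᵀ * D) i j * δ j else 0| ≤
      coherence D * (S.filter fun j => j ≠ i ∧ (Dᵀ * D) i j ≠ 0).card * a := by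
  have hsum : (∑ j, if j ≠ i then (Dᵀ * D) i j * δ j else 0) =
      ∑ j ∈ S.filter (fun j => j ≠ i ∧ (Dᵀ * D) i j ≠ 0), (Dᵀ * D) i j * δ j := by
    rw [← Finset.sum_filter]
    symm
    apply Finset.sum_subset
    · intro j hj
      simp only [Finset.mem_filter, Finset.mem_univ, true_and] at hj ⊢
      exact hj.2.1
    · intro j hj hj'
      simp only [Finset.mem_filter, Finset.mem_univ, true_and] at hj hj'
      by_cases hG : (Dᵀ * D) i j = 0
      · rw [hG, zero_mul]
      · have : δ j = 0 := by
          by_contra h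
          exact hj' ⟨hδ h, hj, hG⟩
        rw [this, mul_zero]
  rw [hsum]
  refine (Finset.abs_sum_le_sum_abs _ _).trans ((Finset.sum_le_card_nsmul _ _
    (coherence D * a) ?_).trans_eq ?_)
  · intro j hj
    rw [abs_mul]
    exact mul_le_mul (abs_gram_le_coherence D (Finset.mem_filter.mp hj).2.1.symm) (ha j)
      (abs_nonneg _) (coherence_nonneg D)
  · rw [nsmul_eq_mul]
    ring

/-- A local form of the restricted isometry property: on vectors supported in `S`, a dictionary
with unit atoms distorts squared norms by a factor of at most `1 ± μ (s - 1)`. -/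
lemma abs_l2_mulVec_sq_sub_le (hD : UnitAtoms D) (hs : GramSparse D S s) {δ : κ → ℝ}
    (hδ : Function.support δ ⊆ ↑S) :
    |l2 (D *ᵥ δ) ^ 2 - l2 δ ^ 2| ≤ coherence D * ((s : ℝ) - 1) * l2 δ ^ 2 := by
  classical
  set w : κ → κ → ℝ := fun i j =>
    if i ∈ S ∧ j ∈ S ∧ j ≠ i ∧ (Dᵀ * D) i j ≠ 0 then 1 else 0 with hw
  have hwsymm : ∀ i j, w i j = w j i := by
    intro i j
    simp only [hw]
    rw [gram_symm D i j]
    congr 1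
    simp only [eq_iff_iff]
    tauto
  have hterm : ∀ i j, |δ i * (if j ≠ i then (Dᵀ * D) i j * δ j else 0)| ≤
      coherence D * (w i j * ((δ i ^ 2 + δ j ^ 2) / 2)) := by
    intro i j
    have hwn : 0 ≤ w i j := by simp only [hw]; split_ifs <;> norm_num
    have hrhs : 0 ≤ coherence D * (w i j * ((δ i ^ 2 + δ j ^ 2) / 2)) :=
      mul_nonneg (coherence_nonneg D) (mul_nonneg hwn (by positivity))
    by_cases h : i ∈ S ∧ j ∈ S ∧ j ≠ i ∧ (Dᵀ * D) i j ≠ 0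
    · have hw1 : w i j = 1 := if_pos h
      rw [if_pos h.2.2.1, hw1, one_mul, mul_left_comm, abs_mul]
      refine mul_le_mul (abs_gram_le_coherence D h.2.2.1.symm) ?_ (abs_nonneg _)
        (coherence_nonneg D)
      rw [abs_le]
      constructor <;> nlinarith [sq_nonneg (δ i - δ j), sq_nonneg (δ i + δ j)]
    · have hz : δ i * (if j ≠ i then (Dᵀ * D) i j * δ j else 0) = 0 := by
        by_contra hne
        have h1 := left_ne_zero_of_mul hne
        have h2 := right_ne_zero_of_mul hne
        by_cases hji : j ≠ i
        · rw [if_pos hji] at h2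
          exact h ⟨hδ h1, hδ (right_ne_zero_of_mul h2), hji, left_ne_zero_of_mul h2⟩
        · exact h2 (if_neg hji)
      rw [hz, abs_zero]
      exact hrhs
  have hrow : ∀ i, δ i ^ 2 * ∑ j, w i j ≤ ((s : ℝ) - 1) * δ i ^ 2 := by
    intro i
    by_cases hi : i ∈ S
    · have : ∑ j, w i j = ((S.filter fun j => j ≠ i ∧ (Dᵀ * D) i j ≠ 0).card : ℝ) := by
        simp only [hw, hi, true_and]
        rw [Finset.sum_boole]
        congr 2
        ext j
        simp
      rw [this, mul_comm]
      exact mul_le_mul_of_nonneg_right (hs.card_offDiag_le hD hi) (sq_nonneg _)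
    · have : δ i = 0 := by
        by_contra h
        exact hi (hδ h)
      simp [this]
  have hdiff : l2 (D *ᵥ δ) ^ 2 - l2 δ ^ 2 =
      ∑ i, ∑ j, δ i * (if j ≠ i then (Dᵀ * D) i j * δ j else 0) := by
    rw [l2_mulVec_sq, l2_sq]
    simp only [dotProduct, gram_mulVec_apply hD, mul_add, Finset.sum_add_distrib, Finset.mul_sum]
    ring
  -- Symmetry of `w` turns the mean of `δ i ^ 2` and `δ j ^ 2` into `δ i ^ 2`.
  have hswap : ∑ i, ∑ j, w i j * ((δ i ^ 2 + δ j ^ 2) / 2) = ∑ i, δ i ^ 2 * ∑ j, w i j := by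
    have h1 : ∑ i, ∑ j, w i j * δ j ^ 2 = ∑ i, ∑ j, w i j * δ i ^ 2 := by
      rw [Finset.sum_comm]
      simp_rw [hwsymm]
    have h2 : ∑ i, ∑ j, w i j * ((δ i ^ 2 + δ j ^ 2) / 2) =
        (∑ i, ∑ j, w i j * δ i ^ 2 + ∑ i, ∑ j, w i j * δ j ^ 2) / 2 := by
      rw [← Finset.sum_add_distrib, Finset.sum_div]
      refine Finset.sum_congr rfl fun i _ => ?_
      rw [← Finset.sum_add_distrib, Finset.sum_div]
      exact Finset.sum_congr rfl fun j _ => by ring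
    rw [h2, h1, add_self_div_two]
    refine Finset.sum_congr rfl fun i _ => ?_
    rw [Finset.mul_sum]
    exact Finset.sum_congr rfl fun j _ => mul_comm _ _
  calc |l2 (D *ᵥ δ) ^ 2 - l2 δ ^ 2|
      ≤ ∑ i, ∑ j, coherence D * (w i j * ((δ i ^ 2 + δ j ^ 2) / 2)) := by
        rw [hdiff]
        refine (Finset.abs_sum_le_sum_abs _ _).trans (Finset.sum_le_sum fun i _ => ?_)
        exact (Finset.abs_sum_le_sum_abs _ _).trans (Finset.sum_le_sum fun j _ => hterm i j)
    _ = coherence D * ∑ i, δ i ^ 2 * ∑ j, w i j := by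
        rw [← hswap]
        simp_rw [Finset.mul_sum]
    _ ≤ coherence D * ∑ i, ((s : ℝ) - 1) * δ i ^ 2 :=
        mul_le_mul_of_nonneg_left (Finset.sum_le_sum fun i _ => hrow i) (coherence_nonneg D)
    _ = coherence D * ((s : ℝ) - 1) * l2 δ ^ 2 := by
        rw [l2_sq, ← Finset.mul_sum, dotProduct, mul_assoc]
        simp_rw [sq]

end Gram

/-! ### Least squares and Orthogonal Matching Pursuit -/

section Pursuit

variable {ι κ : Type*} [Fintype ι] [Fintype κ] {D : Matrix ι κ ℝ}

/-- The normal equations: the residual of a least squares fit is orthogonal to the atoms used. -/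
lemma IsLeastSquares.correlation_eq_zero (hD : UnitAtoms D) {y : ι → ℝ} {T : Finset κ}
    {g : κ → ℝ} (h : IsLeastSquares D y T g) {j : κ} (hj : j ∈ T) :
    (Dᵀ *ᵥ (y - D *ᵥ g)) j = 0 := by
  classical
  obtain ⟨r, hr⟩ : ∃ r, r = y - D *ᵥ g := ⟨_, rfl⟩
  rw [← hr]
  set d : ι → ℝ := fun p => D p j with hd
  have hc : (Dᵀ *ᵥ r) j = d ⬝ᵥ r := rfl
  -- For a unit atom, moving by the correlation itself is the optimal change of coefficient `j`.
  have hle := h.2 (g + Pi.single j (d ⬝ᵥ r)) (by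
    intro i hi
    by_cases hij : i = j
    · exact hij ▸ hj
    · refine h.1 ?_
      simpa [hij] using hi)
  have hres : y - D *ᵥ (g + Pi.single j (d ⬝ᵥ r)) = r - (d ⬝ᵥ r) • d := by
    rw [Matrix.mulVec_add, ← sub_sub, ← hr]
    congr 1
    ext p
    simp [hd, mul_comm]
  have hdd : d ⬝ᵥ d = 1 := by rw [← l2_sq, hD j, one_pow]
  rw [← hr, hres] at hle
  have hsq := pow_le_pow_left₀ (l2_nonneg _) hle 2
  rw [l2_sq, l2_sq] at hsq
  simp only [sub_dotProduct, dotProduct_sub, smul_dotProduct, dotProduct_smul, hdd,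
    smul_eq_mul, dotProduct_comm r d] at hsq
  rw [hc]
  nlinarith [sq_nonneg (d ⬝ᵥ r)]

/-- If the least squares fit uses all atoms of `γ`, then `D (g - γ)` is the projection of the noise
`y - D γ` onto the span of the atoms used, hence no longer than the noise. -/
lemma IsLeastSquares.l2_mulVec_sub_sq_le (hD : UnitAtoms D) {y : ι → ℝ} {T : Finset κ}
    {g γ : κ → ℝ} (h : IsLeastSquares D y T g) (hγ : Function.support γ ⊆ ↑T) :
    l2 (D *ᵥ (g - γ)) ^ 2 ≤ l2 (y - D *ᵥ γ) ^ 2 := by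
  have horth : (D *ᵥ (g - γ)) ⬝ᵥ (y - D *ᵥ g) = 0 := by
    rw [← Matrix.vecMul_transpose, ← Matrix.dotProduct_mulVec, dotProduct]
    refine Finset.sum_eq_zero fun j _ => ?_
    by_cases hj : j ∈ T
    · rw [h.correlation_eq_zero hD hj, mul_zero]
    · have h1 : g j = 0 := by
        by_contra hne
        exact hj (h.1 hne)
      have h2 : γ j = 0 := by
        by_contra hne
        exact hj (hγ hne)
      simp [h1, h2]
  have hy : y - D *ᵥ γ = D *ᵥ (g - γ) + (y - D *ᵥ g) := by
    rw [Matrix.mulVec_sub]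
    abel
  have hr := l2_sq (y - D *ᵥ g)
  rw [hy, l2_sq, l2_sq, add_dotProduct, dotProduct_add, dotProduct_add, horth,
    dotProduct_comm (y - D *ᵥ g) (D *ᵥ (g - γ)), horth, ← hr]
  nlinarith [sq_nonneg (l2 (y - D *ᵥ g))]

lemma OMP.isLeastSquares {y : ι → ℝ} {k : ℕ} {T : Finset κ} {g : κ → ℝ} (h : OMP D y k T g) :
    IsLeastSquares D y T g := by
  cases h with
  | init =>
    refine ⟨by simp, fun g' hg' => ?_⟩
    have : g' = 0 := by simpa using hg'
    rw [this]
  | step _ _ h => exact h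

/-- While the support of `γ` is not exhausted, the largest entry of the error `γ - g` lies at an
atom of `S` whose correlation with the residual is positive and exceeds all those off `S`. -/
lemma exists_mem_forall_notMem_abs_correlation_lt (hD : UnitAtoms D) {S T : Finset κ} {s : ℕ}
    (hs : GramSparse D S s) {y : ι → ℝ} {γ g : κ → ℝ} {ε b : ℝ}
    (hγ : Function.support γ ⊆ ↑S) (hb : ∀ j ∈ S, b ≤ |γ j|)
    (hε : ∀ j, |(Dᵀ *ᵥ (y - D *ᵥ γ)) j| ≤ ε)
    (hgap : 2 * ε < (1 - coherence D * (2 * (s : ℝ) - 1)) * b) (hb0 : 0 < b)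
    (hg : Function.support g ⊆ ↑T) (hTS : T ⊂ S) :
    ∃ i ∈ S, 0 < |(Dᵀ *ᵥ (y - D *ᵥ g)) i| ∧
      ∀ k ∉ S, |(Dᵀ *ᵥ (y - D *ᵥ g)) k| < |(Dᵀ *ᵥ (y - D *ᵥ g)) i| := by
  classical
  obtain ⟨l, hlS, hlT⟩ := Finset.exists_of_ssubset hTS
  set δ := γ - g with hδdef
  have hδ : Function.support δ ⊆ ↑S := by
    intro j hj
    by_contra hjS
    have h1 : γ j = 0 := by
      by_contra h
      exact hjS (hγ h)
    have h2 : g j = 0 := by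
      by_contra h
      exact hjS (hTS.1 (hg h))
    exact hj (by simp [hδdef, h1, h2])
  have : Nonempty κ := ⟨l⟩
  obtain ⟨i, hi⟩ := Finite.exists_max fun j => |δ j|
  set a := |δ i| with ha
  have hba : b ≤ a := by
    have hl : δ l = γ l := by
      have : g l = 0 := by
        by_contra h
        exact hlT (hg h)
      simp [hδdef, this]
    calc b ≤ |γ l| := hb l hlS
      _ = |δ l| := by rw [hl]
      _ ≤ a := hi l
  have hiS : i ∈ S := by
    refine hδ fun h => ?_
    rw [ha, h, abs_zero] at hba
    exact hb0.not_ge hba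
  have hcorr : ∀ k, (Dᵀ *ᵥ (y - D *ᵥ g)) k =
      δ k + (∑ j, if j ≠ k then (Dᵀ * D) k j * δ j else 0) + (Dᵀ *ᵥ (y - D *ᵥ γ)) k := by
    intro k
    have hr : y - D *ᵥ g = D *ᵥ δ + (y - D *ᵥ γ) := by
      rw [hδdef, Matrix.mulVec_sub]
      abel
    rw [hr, Matrix.mulVec_add, Pi.add_apply, Matrix.mulVec_mulVec, gram_mulVec_apply hD]
  have hs1 : (1 : ℝ) ≤ s := by exact_mod_cast hs.one_le hD hiS
  have hμ := coherence_nonneg D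
  have ha0 : 0 < a := hb0.trans_le hba
  have hε0 : 0 ≤ ε := (abs_nonneg _).trans (hε i)
  have hgap' : 2 * ε < (1 - coherence D * (2 * (s : ℝ) - 1)) * a := by
    have hpos : 0 < 1 - coherence D * (2 * (s : ℝ) - 1) := by
      by_contra h
      nlinarith
    exact hgap.trans_le (mul_le_mul_of_nonneg_left hba hpos.le)
  have hlow : a - coherence D * ((s : ℝ) - 1) * a - ε ≤ |(Dᵀ *ᵥ (y - D *ᵥ g)) i| := by
    have h1 := (abs_offDiag_sum_le D hδ hi i).trans (mul_le_mul_of_nonneg_right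
      (mul_le_mul_of_nonneg_left (hs.card_offDiag_le hD hiS) hμ) ha0.le)
    have h2 := hε i
    rw [hcorr i]
    have h3 := abs_sub_abs_le_abs_add (δ i + ∑ j, if j ≠ i then (Dᵀ * D) i j * δ j else 0)
      ((Dᵀ *ᵥ (y - D *ᵥ γ)) i)
    have h4 := abs_sub_abs_le_abs_add (δ i) (∑ j, if j ≠ i then (Dᵀ * D) i j * δ j else 0)
    linarith
  refine ⟨i, hiS, ?_, fun k hk => ?_⟩
  · nlinarith [mul_nonneg (mul_nonneg hμ (zero_le_one.trans hs1)) ha0.le]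
  · have hδk : δ k = 0 := by
      by_contra h
      exact hk (hδ h)
    have hcard : ((S.filter fun j => j ≠ k ∧ (Dᵀ * D) k j ≠ 0).card : ℝ) ≤ s := by
      refine Nat.cast_le.mpr ((Finset.card_le_card fun j hj => ?_).trans (hs k))
      simp only [Finset.mem_filter] at hj ⊢
      exact ⟨hj.1, hj.2.2⟩
    have h1 := (abs_offDiag_sum_le D hδ hi k).trans (mul_le_mul_of_nonneg_right
      (mul_le_mul_of_nonneg_left hcard hμ) ha0.le)
    have h2 := hε k
    refine lt_of_le_of_lt (b := coherence D * s * a + ε) ?_ (lt_of_lt_of_le ?_ hlow)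
    · rw [hcorr k, hδk, zero_add]
      exact (abs_add_le _ _).trans (add_le_add h1 h2)
    · linarith

/-- Orthogonal Matching Pursuit selects a new atom of the true support in each of its first `|S|`
iterations. -/
lemma OMP.subset_support (hD : UnitAtoms D) {S : Finset κ} {s : ℕ} (hs : GramSparse D S s)
    {y : ι → ℝ} {γ : κ → ℝ} {ε b : ℝ} (hγ : Function.support γ ⊆ ↑S)
    (hb : ∀ j ∈ S, b ≤ |γ j|) (hε : ∀ j, |(Dᵀ *ᵥ (y - D *ᵥ γ)) j| ≤ ε)
    (hgap : 2 * ε < (1 - coherence D * (2 * (s : ℝ) - 1)) * b) (hb0 : 0 < b)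
    {k : ℕ} {T : Finset κ} {g : κ → ℝ} (h : OMP D y k T g) (hk : k ≤ S.card) :
    T ⊆ S ∧ T.card = k := by
  classical
  induction h with
  | init => simp
  | @step k T g g' j hprev hmax hls ih =>
    obtain ⟨hTS, hcard⟩ := ih (by omega)
    have hss : T ⊂ S := by
      refine hTS.ssubset_of_ne fun h => ?_
      rw [h] at hcard
      omega
    obtain ⟨i, hiS, hipos, hi⟩ := exists_mem_forall_notMem_abs_correlation_lt hD hs hγ hb hε hgap
      hb0 hprev.isLeastSquares.1 hss
    have hjS : j ∈ S := by
      by_contra hj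
      exact (hi j hj).not_ge (hmax i)
    have hjT : j ∉ T := by
      intro hj
      have h0 := hprev.isLeastSquares.correlation_eq_zero hD hj
      have := hmax i
      rw [h0, abs_zero] at this
      exact hipos.not_ge this
    have hcard' := Finset.card_insert_of_notMem hjT
    constructor
    · intro x hx
      rcases Finset.mem_insert.mp (by convert hx) with rfl | hx
      · exact hjS
      · exact hTS hx
    · convert hcard'
      exact hcard.symm

end Pursuit

/-! ### Convolutional dictionaries -/

section Convolutional

variable {N : ℕ} [NeZero N]

/-- The atoms of `D` have length `n`: the atom at location `q` vanishes off the locations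
`q, …, q + n - 1`. -/
def HasAtomLength {m' m : ℕ} (n : ℕ) (D : Matrix (ZMod N × Fin m') (ZMod N × Fin m) ℝ) : Prop :=
  ∀ p q, D p q ≠ 0 → (p.1 - q.1).val < n

omit [NeZero N] in
lemma hasAtomLength_convDict {m' m n : ℕ} (f : Fin m → Fin n → Fin m' → ℝ) :
    HasAtomLength n (convDict (N := N) f) := by
  intro p q h
  by_contra hlt
  exact h (by simp [convDict, hlt])

/-- Composing layers adds up the spatial offsets, each less than the filter length. Written with
`+`, the bound also covers `i = 0`, where `effLen` is `0` although the atoms of `1` have length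
one. -/
lemma val_add_le_of_effDict_ne_zero {m n : ℕ → ℕ}
    (f : (i : ℕ) → Fin (m (i + 1)) → Fin (n i) → Fin (m i) → ℝ) (i : ℕ)
    (p : ZMod N × Fin (m 0)) (q : ZMod N × Fin (m i)) (h : effDict N f i p q ≠ 0) :
    (p.1 - q.1).val + i ≤ ∑ j ∈ Finset.range i, n j := by
  induction i with
  | zero =>
    have : p = q := by
      by_contra hne
      exact h (Matrix.one_apply_ne hne)
    simp [this]
  | succ i ih =>
    have h' : (∑ r, effDict N f i p r * dict N f i r q) ≠ 0 := h
    obtain ⟨r, -, hr⟩ := Finset.exists_ne_zero_of_sum_ne_zero h'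
    have h1 := ih r (left_ne_zero_of_mul hr)
    have h2 := hasAtomLength_convDict (f i) r q (right_ne_zero_of_mul hr)
    have h3 := ZMod.val_add_le (p.1 - r.1) (r.1 - q.1)
    rw [sub_add_sub_cancel] at h3
    rw [Finset.sum_range_succ]
    omega

lemma hasAtomLength_effDict {m n : ℕ → ℕ}
    (f : (i : ℕ) → Fin (m (i + 1)) → Fin (n i) → Fin (m i) → ℝ) {L : ℕ} (hL : 1 ≤ L) :
    HasAtomLength (effLen n L) (effDict N f L) := by
  intro p q h
  have := val_add_le_of_effDict_ne_zero f L p q h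
  rw [effLen]
  omega

lemma val_sub_lt_or_of_val_lt {n : ℕ} {x s t : ZMod N} (hs : (x - s).val < n)
    (ht : (x - t).val < n) : (s - t).val < n ∨ (t - s).val < n := by
  rcases le_total (x - s).val (x - t).val with h | h
  · left
    have := ZMod.val_sub h
    rw [sub_sub_sub_cancel_left] at this
    omega
  · right
    have := ZMod.val_sub h
    rw [sub_sub_sub_cancel_left] at this
    omega

lemma l0_stripe_le_stripeL0 {m : ℕ} (n : ℕ) (g : ZMod N × Fin m → ℝ) (t : ZMod N) :
    l0 (stripe n g t) ≤ stripeL0 n g :=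
  Finset.le_sup (f := fun t => l0 (stripe n g t)) (Finset.mem_univ t)

lemma l2_patch_le_patchL2 {m : ℕ} (n : ℕ) (v : ZMod N × Fin m → ℝ) (t : ZMod N) :
    l2 (patch n v t) ≤ patchL2 n v :=
  Finset.le_sup' (fun t => l2 (patch n v t)) (Finset.mem_univ t)

open Classical in
/-- Atoms that overlap are in each other's stripe. -/
lemma gramSparse_of_hasAtomLength {m' m n : ℕ} {D : Matrix (ZMod N × Fin m') (ZMod N × Fin m) ℝ}
    (hD : HasAtomLength n D) (γ : ZMod N × Fin m → ℝ) :
    GramSparse D (Finset.univ.filter fun j => γ j ≠ 0) (stripeL0 n γ) := by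
  intro i
  refine le_trans ?_ (l0_stripe_le_stripeL0 n γ i.1)
  rw [l0]
  refine le_of_eq_of_le (by congr) (Finset.card_le_card (s := Finset.filter
    (fun j => (Dᵀ * D) i j ≠ 0) (Finset.univ.filter fun j => γ j ≠ 0)) fun j hj => ?_)
  simp only [Finset.mem_filter, Finset.mem_univ, true_and] at hj ⊢
  obtain ⟨hγ, hG⟩ := hj
  rw [Matrix.mul_apply] at hG
  obtain ⟨p, -, hp⟩ := Finset.exists_ne_zero_of_sum_ne_zero hG
  have hor := val_sub_lt_or_of_val_lt (hD p j (right_ne_zero_of_mul hp))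
    (hD p i (left_ne_zero_of_mul hp))
  rw [stripe, if_pos hor]
  exact hγ

lemma abs_transpose_mulVec_le_patchL2 {m' m n : ℕ}
    {D : Matrix (ZMod N × Fin m') (ZMod N × Fin m) ℝ} (hunit : UnitAtoms D)
    (hD : HasAtomLength n D) (v : ZMod N × Fin m' → ℝ) (j : ZMod N × Fin m) :
    |(Dᵀ *ᵥ v) j| ≤ patchL2 n v := by
  have h : (Dᵀ *ᵥ v) j = (fun p => D p j) ⬝ᵥ patch n v j.1 := by
    simp only [Matrix.mulVec, dotProduct, Matrix.transpose_apply]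
    refine Finset.sum_congr rfl fun p _ => ?_
    by_cases hp : D p j = 0
    · rw [hp, zero_mul, zero_mul]
    · rw [patch, if_pos (hD p j hp)]
  rw [h]
  refine (abs_dotProduct_le_l2_mul_l2 _ _).trans ?_
  rw [hunit j, one_mul]
  exact l2_patch_le_patchL2 n v j.1

lemma InModel.eq_effDict_mulVec {m n : ℕ → ℕ} {L : ℕ}
    {f : (i : ℕ) → Fin (m (i + 1)) → Fin (n i) → Fin (m i) → ℝ} {lam : ℕ → ℕ}
    {γ : (i : ℕ) → ZMod N × Fin (m i) → ℝ} (h : InModel L f lam γ) {i : ℕ} (hi : i ≤ L) :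
    γ 0 = effDict N f i *ᵥ γ i := by
  induction i with
  | zero => exact (Matrix.one_mulVec _).symm
  | succ i ih =>
    rw [ih (by omega), (h i hi).1, Matrix.mulVec_mulVec]
    rfl

end Convolutional

/-! ### Propagation to shallower layers -/

/-- Under the non-vanishing support property, atoms in the support of `γ` cannot produce anything
outside the support of `D γ`. -/
lemma NVS.support_mulVec_subset {ι κ : Type*} [Fintype ι] [Fintype κ] {D : Matrix ι κ ℝ}
    {γ g : κ → ℝ} (h : NVS D γ) (hg : Function.support g ⊆ Function.support γ) :
    Function.support (D *ᵥ g) ⊆ Function.support (D *ᵥ γ) := by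
  classical
  have hrow : ∀ g' : κ → ℝ, ∀ p, (D *ᵥ g') p ≠ 0 → ∃ j, g' j ≠ 0 ∧ D p j ≠ 0 := by
    intro g' p hp
    obtain ⟨j, -, hj⟩ := Finset.exists_ne_zero_of_sum_ne_zero hp
    exact ⟨j, right_ne_zero_of_mul hj, left_ne_zero_of_mul hj⟩
  have heq : (Finset.univ.filter fun p => (D *ᵥ γ) p ≠ 0) =
      Finset.univ.filter fun p => ∃ j, γ j ≠ 0 ∧ D p j ≠ 0 := by
    refine Finset.eq_of_subset_of_card_le (fun p hp => ?_) (le_of_eq ?_)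
    · simp only [Finset.mem_filter, Finset.mem_univ, true_and] at hp ⊢
      exact hrow γ p hp
    · rw [NVS, l0] at h
      convert h.symm
  intro p hp
  obtain ⟨j, hj, hDj⟩ := hrow g p hp
  have hmem : p ∈ Finset.univ.filter fun p => ∃ j, γ j ≠ 0 ∧ D p j ≠ 0 := by
    simp only [Finset.mem_filter, Finset.mem_univ, true_and]
    exact ⟨j, hg hj, hDj⟩
  rw [← heq] at hmem
  exact (Finset.mem_filter.mp hmem).2

section Recovery

variable {N : ℕ} [NeZero N] {m' m n : ℕ} {D : Matrix (ZMod N × Fin m') (ZMod N × Fin m) ℝ}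

/-- Below the coherence threshold, a dictionary increases squared errors by at most `3 / 2`, since
`μ (2 λ - 1) ≤ 1` gives `μ (λ - 1) ≤ 1 / 2`. -/
lemma l2_mulVec_sq_le_three_halves (hunit : UnitAtoms D) (hD : HasAtomLength n D)
    {γ δ : ZMod N × Fin m → ℝ} (hδ : Function.support δ ⊆ Function.support γ)
    (hcoh : coherence D * (2 * (stripeL0 n γ : ℝ) - 1) ≤ 1) :
    l2 (D *ᵥ δ) ^ 2 ≤ 3 / 2 * l2 δ ^ 2 := by
  classical
  have h := (abs_le.mp (abs_l2_mulVec_sq_sub_le hunit (gramSparse_of_hasAtomLength hD γ)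
    (δ := δ) (by simpa using hδ))).2
  nlinarith [coherence_nonneg D, sq_nonneg (l2 δ)]

/-- Stable recovery by Orthogonal Matching Pursuit with a dictionary of atoms of length `n`. -/
lemma OMP.stable_recovery (hunit : UnitAtoms D) (hD : HasAtomLength n D)
    {γ g : ZMod N × Fin m → ℝ} {y : ZMod N × Fin m' → ℝ} {T : Finset (ZMod N × Fin m)} {E : ℝ}
    (hE : l2 (y - D *ᵥ γ) ≤ E)
    (hcoh : coherence D * (2 * (stripeL0 n γ : ℝ) - 1) <
      1 - 2 * (patchL2 n (y - D *ᵥ γ) / minAbs γ))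
    (h : OMP D y (l0 γ) T g) :
    Function.support g ⊆ Function.support γ ∧
      l2 (g - γ) ^ 2 ≤ E ^ 2 / (1 - coherence D * ((stripeL0 n γ : ℝ) - 1)) := by
  classical
  have hμ := coherence_nonneg D
  set S : Finset (ZMod N × Fin m) := Finset.univ.filter fun j => γ j ≠ 0 with hSdef
  have hS : Function.support γ = ↑S := by
    ext j
    simp [hSdef]
  have hcard : l0 γ = S.card := by
    rw [l0, hSdef]
  have hsparse : GramSparse D S (stripeL0 n γ) := by
    convert gramSparse_of_hasAtomLength hD γ
  have hP : 0 ≤ patchL2 n (y - D *ᵥ γ) := (l2_nonneg _).trans (l2_patch_le_patchL2 n _ 0)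
  have hT : T = S := by
    -- For `γ = 0` the value of `minAbs` is junk, but no iteration takes place.
    by_cases hγ : γ = 0
    · subst hγ
      have hS0 : S = ∅ := by simp [hSdef]
      rw [hcard, hS0, Finset.card_empty] at h
      cases h
      exact hS0.symm
    · have hb0 := minAbs_pos hγ
      have hgap : 2 * patchL2 n (y - D *ᵥ γ) <
          (1 - coherence D * (2 * (stripeL0 n γ : ℝ) - 1)) * minAbs γ := by
        rw [← div_lt_iff₀ hb0, mul_div_assoc]
        linarith
      obtain ⟨hsub, hc⟩ := OMP.subset_support hunit hsparse hS.subset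
        (fun j hj => minAbs_le γ (Finset.mem_filter.mp hj).2)
        (abs_transpose_mulVec_le_patchL2 hunit hD _) hgap hb0 h hcard.le
      exact Finset.eq_of_subset_of_card_le hsub (by rw [hc, hcard])
  have hls := h.isLeastSquares
  have hsupp : Function.support g ⊆ Function.support γ := by
    rw [hS, ← hT]
    exact hls.1
  refine ⟨hsupp, ?_⟩
  have hδ : Function.support (g - γ) ⊆ ↑S := by
    rw [← hS]
    exact (Function.support_sub g γ).trans (Set.union_subset hsupp subset_rfl)
  have hnoise := hls.l2_mulVec_sub_sq_le hunit (hS.subset.trans (by rw [hT]))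
  have hlow := (abs_le.mp (abs_l2_mulVec_sq_sub_le hunit hsparse hδ)).1
  have hE2 := pow_le_pow_left₀ (l2_nonneg _) hE 2
  -- Only the sign of the noise term is needed here, so that `γ = 0` is no exception.
  have hmin : 0 ≤ minAbs γ := by
    refine Real.sInf_nonneg ?_
    rintro a ⟨j, -, rfl⟩
    exact abs_nonneg _
  have hquot := div_nonneg hP hmin
  have hden : 0 < 1 - coherence D * ((stripeL0 n γ : ℝ) - 1) := by
    nlinarith [mul_nonneg hμ (Nat.cast_nonneg (α := ℝ) (stripeL0 n γ))]
  rw [le_div_iff₀ hden]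
  linarith

end Recovery

end MLCSC

theorem theorem7 (N : ℕ) [NeZero N] (L : ℕ) (hL : 1 ≤ L) (m n : ℕ → ℕ) (hm : m 0 = 1)
    (hn : ∀ i < L, 1 ≤ n i ∧ n i ≤ N)
    (f : (i : ℕ) → Fin (m (i + 1)) → Fin (n i) → Fin (m i) → ℝ)
    -- all atoms, of the dictionaries and of the effective dictionary, are normalized
    (hunit : ∀ i < L, MLCSC.UnitAtoms (MLCSC.dict N f i))
    (hunitL : MLCSC.UnitAtoms (MLCSC.effDict N f L))
    -- the signal `x = γ 0` and its representations `γ 1, …, γ L`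
    (lam : ℕ → ℕ) (γ : (i : ℕ) → ZMod N × Fin (m i) → ℝ)
    (hmodel : MLCSC.InModel L f lam γ)
    -- the measurements
    (y : ZMod N × Fin (m 0) → ℝ) (E₀ ε₀ : ℝ)
    (hE : MLCSC.l2 (y - γ 0) ≤ E₀)
    (hε : ε₀ = MLCSC.patchL2 (MLCSC.effLen n L) (y - γ 0))
    (hNVS : ∀ i < L, MLCSC.NVS (MLCSC.dict N f i) (γ (i + 1)))
    (hlam : ∀ i < L, MLCSC.stripeL0 (n i) (γ (i + 1)) = lam (i + 1))
    -- `λ < (1 + 1 / μ) / 2`, multiplied by `2 μ`, so that `μ = 0` imposes no restriction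
    (hcoh : ∀ i < L, MLCSC.coherence (MLCSC.dict N f i) * (2 * (lam (i + 1) : ℝ) - 1) < 1)
    -- `‖γ_L‖ < (1 + 1 / μ) / 2 - (1 / μ) (ε₀ / |γ_min|)`, multiplied by `2 μ`
    (hcohL : MLCSC.coherence (MLCSC.effDict N f L) *
        (2 * (MLCSC.stripeL0 (MLCSC.effLen n L) (γ L) : ℝ) - 1) <
      1 - 2 * (ε₀ / MLCSC.minAbs (γ L)))
    (γh : (i : ℕ) → ZMod N × Fin (m i) → ℝ)
    (hpursuit : MLCSC.IsMLPursuit L f y (MLCSC.l0 (γ L)) γh) :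
    ∀ i, 1 ≤ i → i ≤ L →
      Function.support (γh i) ⊆ Function.support (γ i) ∧
      MLCSC.l2 (γh i - γ i) ^ 2 ≤
        E₀ ^ 2 / (1 - MLCSC.coherence (MLCSC.effDict N f L) *
          ((MLCSC.stripeL0 (MLCSC.effLen n L) (γ L) : ℝ) - 1)) * (3 / 2 : ℝ) ^ (L - i) := by
  have hx : γ 0 = MLCSC.effDict N f L *ᵥ γ L := hmodel.eq_effDict_mulVec le_rfl
  obtain ⟨⟨T, hT⟩, hprop⟩ := hpursuit
  have hdeep := hT.stable_recovery hunitL (MLCSC.hasAtomLength_effDict f hL) (hx ▸ hE)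
    (by rw [← hx, ← hε]; exact hcohL)
  intro i hi1 hiL
  clear hi1
  induction hiL using Nat.decreasingInduction with
  | self => simpa using hdeep
  | of_succ i hi ih =>
    obtain ⟨hsupp, hbound⟩ := ih
    obtain ⟨hγ, -⟩ := hmodel i hi
    have hγh := hprop i hi
    have hstep := MLCSC.l2_mulVec_sq_le_three_halves (D := MLCSC.dict N f i)
      (δ := γh (i + 1) - γ (i + 1)) (hunit i hi) (MLCSC.hasAtomLength_convDict (f i))
      ((Function.support_sub (γh (i + 1)) (γ (i + 1))).trans (Set.union_subset hsupp subset_rfl))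
      (by rw [hlam i hi]; exact (hcoh i hi).le)
    rw [Matrix.mulVec_sub, ← hγh, ← hγ] at hstep
    refine ⟨?_, ?_⟩
    · rw [hγh, hγ]
      exact (hNVS i hi).support_mulVec_subset hsupp
    · have hpow : L - i = (L - (i + 1)) + 1 := by omega
      rw [hpow, pow_succ (3 / 2 : ℝ)]
      linarith
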